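/- All graphs are undirected, connected and endowed with the graph distance $d$. For vertices $w,x,y$ of a graph $G$ let $(x|y)_w=\frac12\bigl(d(x,w)+d(y,w)-d(x,y)\bigr)$. The hyperbolicity $\delta(G)$ is the least $\delta\ge 0$ such that $(x|y)_w\ge\min\{(x|z)_w,(y|z)_w\}-\delta$ for all vertices $w,x,y,z$. A BFS-tree of $G$ rooted at $w$ is a spanning tree $T$ of $G$ such that for every vertex $x$ the path $[w,x]_T$ of $T$ from $w$ to $x$ is a shortest path of $G$. Given such $w$ and $T$, for vertices $x,y$ let $x_y\in[w,x]_T$ and $y_x\in[w,y]_T$ be the vertices at distance $\lfloor (x|y)_w\rfloor$ from $w$; the rooted insize of $G$ is $\rho_{w,T}(G)=\max\{d(x_y,y_x): x,y\in V(G)\}$. The $n\times n$ grid is the graph on $\{0,\dots,n\}^2$ in which two vertices are adjacent if and only if they differ by exactly $1$ in one coordinate and agree in the other. Let $k$ be any positive integer. (1) Let $H_k$ be the subgraph of the $2k\times 2k$ grid induced by the vertices $(i,j)$ with $i\le k$ or $j\le k$ (that is, the corner square $k<i,j\le 2k$ is removed). Then $\delta(H_k)=k$, and there are a vertex $w$ and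 a BFS-tree $T$ of $H_k$ rooted at $w$ such that $\rho_{w,T}(H_k)=4k$. (2) Let $G_k$ be the $4k\times 4k$ grid. Then $\delta(G_k)=4k$, and there are a vertex $w$ and a BFS-tree $T$ of $G_k$ rooted at $w$ such that $\rho_{w,T}(G_k)\le 2k$. Consequently, the multiplicative constants in the inequalities $\rho_{w,T}(G)\le 4\,\delta(G)$ and $\delta(G)\le 2\rho_{w,T}(G)+1$ are optimal, even for finite graphs: if $a,b$ are real numbers such that $\rho_{w,T}(G)\le a\,\delta(G)+b$ for every finite graph $G$, vertex $w$ and BFS-tree $T$ of $G$ rooted at $w$, then $a\ge 4$; and if $a,b$ are real numbers such that $\delta(G)\le a\,\rho_{w,T}(G)+b$ for all such $G,w,T$, then $a\ge 2$. -/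

import Mathlib

namespace SimpleGraph

/-- The Gromov product `(x|y)_w = (d(x,w) + d(y,w) - d(x,y)) / 2` for the graph distance of `G`. -/
noncomputable def gromovProd {V : Type*} (G : SimpleGraph V) (w x y : V) : ℝ :=
  ((G.dist x w : ℝ) + (G.dist y w : ℝ) - (G.dist x y : ℝ)) / 2

/-- `G` is `δ`-hyperbolic: `δ ≥ 0` and `(x|y)_w ≥ min {(x|z)_w, (y|z)_w} - δ` for all vertices. -/
def IsHyperbolicWith {V : Type*} (G : SimpleGraph V) (δ : ℝ) : Prop :=
  0 ≤ δ ∧ ∀ w x y z : V,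
    min (G.gromovProd w x z) (G.gromovProd w y z) - δ ≤ G.gromovProd w x y

/-- `δ(G) = δ`: the hyperbolicity of `G`, the least `δ ≥ 0` for which `G` is `δ`-hyperbolic,
exists and equals `δ`. -/
def HasHyperbolicity {V : Type*} (G : SimpleGraph V) (δ : ℝ) : Prop :=
  IsLeast {ε : ℝ | G.IsHyperbolicWith ε} δ

/-- `T` is a BFS-tree of `G` rooted at `w`: a spanning tree of `G` in which the path from `w`
to any vertex is a shortest path of `G`. -/
structure IsBFSTree {V : Type*} (G T : SimpleGraph V) (w : V) : Prop where
  le : T ≤ G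
  isTree : T.IsTree
  dist_eq : ∀ x : V, T.dist w x = G.dist w x

/-- `u` is a vertex of the path `[w,x]_T` of `T` at distance `r` from `w` in `G`. -/
def IsTreePathVertex {V : Type*} (G T : SimpleGraph V) (w x : V) (r : ℕ) (u : V) : Prop :=
  (∃ p : T.Walk w x, p.IsPath ∧ u ∈ p.support) ∧ G.dist w u = r

/-- The distances `d(x_y, y_x)`, for `x` and `y` ranging over the vertices of `G`, where
`x_y ∈ [w,x]_T` and `y_x ∈ [w,y]_T` are the vertices at distance `⌊(x|y)_w⌋` from `w`. -/
def rootedInsizeSet {V : Type*} (G T : SimpleGraph V) (w : V) : Set ℕ :=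
  {n | ∃ x y u v : V, IsTreePathVertex G T w x ⌊G.gromovProd w x y⌋₊ u ∧
    IsTreePathVertex G T w y ⌊G.gromovProd w x y⌋₊ v ∧ G.dist u v = n}

/-- `ρ_{w,T}(G) = ρ`: the rooted insize `max {d(x_y, y_x) : x, y ∈ V}` exists and equals `ρ`. -/
def HasRootedInsize {V : Type*} (G T : SimpleGraph V) (w : V) (ρ : ℕ) : Prop :=
  IsGreatest (rootedInsizeSet G T w) ρ

/-- The `n × n` square grid (`n` is the side length, so there are `n + 1` vertices per side). -/
def squareGrid (n : ℕ) : SimpleGraph (Fin (n + 1) × Fin (n + 1)) :=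
  pathGraph (n + 1) □ pathGraph (n + 1)

/-- The vertices `(i, j)` of the `2k × 2k` grid with `i ≤ k` or `j ≤ k`; what is missing is the
corner square `k < i, j ≤ 2k`. -/
def cutGridVerts (k : ℕ) : Set (Fin (2 * k + 1) × Fin (2 * k + 1)) :=
  {p | (p.1 : ℕ) ≤ k ∨ (p.2 : ℕ) ≤ k}

/-- The `2k × 2k` grid with a corner square of side length `k - 1` removed. -/
def cutGrid (k : ℕ) : SimpleGraph (cutGridVerts k) :=
  (squareGrid (2 * k)).induce (cutGridVerts k)

end SimpleGraph

/-! ### Distances from level functions -/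

namespace SimpleGraph

/-! Both graphs sit isometrically in `ℤ × ℤ` with the `ℓ¹` metric (`IsGridEmbedding`), so everything
reduces to integer inequalities. Trees are given by parent maps.

Hyperbolicity: isometric squares give the lower bounds. For the upper bounds, each coordinate is a
line, hence `0`-hyperbolic, and a defect arises only when the two coordinates favour different
pairings. A defect above `2k` in `cutGrid k` would force a vertex into the removed corner
(`l1Dist_four_point_of_cut`). In the full grid the second coordinate alone bounds the defect
(`l1Dist_four_point_of_natAbs_le`).

Insize: in `cutGrid k` the tree paths from the tips `(k, 2k)` and `(2k, k)` retreat to opposite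
axes, reaching points at distance `4k`. In the full grid, rooted at the centre, paths follow the
diagonals, which keeps them close together (`l1Dist_le_of_isDiagonalAncestor`). -/

/-- If `ℓ` vanishes at `x`, changes by at most one along edges, and every vertex other than `x` has
a neighbour with smaller `ℓ`, then `ℓ` is the distance from `x`. -/
lemma reachable_and_dist_eq_of_level {V : Type*} {G : SimpleGraph V} {x : V} {ℓ : V → ℕ}
    (h0 : ℓ x = 0) (hlip : ∀ y z, G.Adj y z → ℓ z ≤ ℓ y + 1)
    (hdesc : ∀ y, y ≠ x → ∃ z, G.Adj y z ∧ ℓ z + 1 = ℓ y) (y : V) :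
    G.Reachable x y ∧ G.dist x y = ℓ y := by
  have hup : ∀ (n : ℕ) (y : V), ℓ y = n → ∃ p : G.Walk x y, p.length = n := by
    intro n
    induction n with
    | zero =>
      intro y hy
      by_cases hyx : y = x
      · subst hyx
        exact ⟨.nil, rfl⟩
      · obtain ⟨z, -, hz⟩ := hdesc y hyx
        omega
    | succ n ih =>
      intro y hy
      have hyx : y ≠ x := by
        rintro rfl
        omega
      obtain ⟨z, hadj, hz⟩ := hdesc y hyx
      obtain ⟨p, hp⟩ := ih z (by omega)
      exact ⟨p.concat hadj.symm, by simp [hp]⟩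
  have hlow : ∀ {u v : V} (p : G.Walk u v), ℓ v ≤ ℓ u + p.length := by
    intro u v p
    induction p with
    | nil => simp
    | cons h p ih =>
      have := hlip _ _ h
      simp only [Walk.length_cons]
      omega
  obtain ⟨p, hp⟩ := hup _ y rfl
  refine ⟨⟨p⟩, le_antisymm (hp ▸ dist_le p) ?_⟩
  obtain ⟨q, hq⟩ := Reachable.exists_walk_length_eq_dist (G := G) (u := x) (v := y) ⟨p⟩
  have := hlow q
  omega

/-! ### BFS-trees from parent maps -/

/-- `f` sends every vertex other than the root `w` to a `G`-neighbour whose distance to `w` is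
smaller by one, and fixes the root. -/
structure IsParentMap {V : Type*} (G : SimpleGraph V) (w : V) (f : V → V) : Prop where
  root : f w = w
  adj : ∀ x, x ≠ w → G.Adj x (f x)
  dist : ∀ x, x ≠ w → G.dist w (f x) + 1 = G.dist w x

/-- The graph joining every vertex to its image under `f`. -/
def parentGraph {V : Type*} (f : V → V) : SimpleGraph V :=
  fromRel fun x y => y = f x

namespace IsParentMap

variable {V : Type*} {G : SimpleGraph V} {w : V} {f : V → V}

lemma parentGraph_adj_self (hf : G.IsParentMap w f) {x : V} (hx : x ≠ w) :
    (parentGraph f).Adj x (f x) := by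
  rw [parentGraph, fromRel_adj]
  exact ⟨(hf.adj x hx).ne, Or.inl rfl⟩

lemma reachable_and_dist_eq (hf : G.IsParentMap w f) (x : V) :
    (parentGraph f).Reachable w x ∧ (parentGraph f).dist w x = G.dist w x := by
  refine reachable_and_dist_eq_of_level (ℓ := fun x => G.dist w x) (by simp) ?_
    (fun y hy => ⟨f y, hf.parentGraph_adj_self hy, hf.dist y hy⟩) x
  intro y z h
  rw [parentGraph, fromRel_adj] at h
  obtain ⟨hne, rfl | rfl⟩ := h
  · by_cases hy : y = w
    · exact absurd (hy ▸ hf.root.symm) hne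
    · have := hf.dist y hy
      omega
  · by_cases hz : z = w
    · subst hz
      simp
    · exact (hf.dist z hz).ge

lemma isTree [Finite V] (hf : G.IsParentMap w f) : (parentGraph f).IsTree := by
  have hconn : (parentGraph f).Connected :=
    { preconnected := fun x y =>
        (hf.reachable_and_dist_eq x).1.symm.trans (hf.reachable_and_dist_eq y).1
      nonempty := ⟨w⟩ }
  refine isTree_iff_connected_and_card.2
    ⟨hconn, le_antisymm ?_ hconn.card_vert_le_card_edgeSet_add_one⟩
  -- Each edge comes from a non-root vertex, so there are at most `|V| - 1` edges; with
  -- connectedness this gives a tree.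
  have hsub : (parentGraph f).edgeSet ⊆ (fun x => s(x, f x)) '' {w}ᶜ := by
    intro e
    induction e with | h x y
    intro h
    rw [mem_edgeSet, parentGraph, fromRel_adj] at h
    obtain ⟨hne, rfl | rfl⟩ := h
    · exact ⟨x, fun hx => hne (by rw [Set.mem_singleton_iff.1 hx, hf.root]), rfl⟩
    · exact ⟨y, fun hy => hne (by rw [Set.mem_singleton_iff.1 hy, hf.root]), Sym2.eq_swap⟩
  have h1 := (Set.ncard_le_ncard hsub (Set.toFinite _)).trans (Set.ncard_image_le (Set.toFinite _))
  have h2 := Set.ncard_add_ncard_compl ({w} : Set V)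
  rw [Set.ncard_singleton] at h2
  rw [Nat.card_coe_set_eq]
  omega

lemma isBFSTree [Finite V] (hf : G.IsParentMap w f) : G.IsBFSTree (parentGraph f) w where
  le := by
    intro x y h
    rw [parentGraph, fromRel_adj] at h
    obtain ⟨hne, rfl | rfl⟩ := h
    · exact hf.adj x fun hx => hne (by rw [hx, hf.root])
    · exact (hf.adj y fun hy => hne (by rw [hy, hf.root])).symm
  isTree := hf.isTree
  dist_eq x := (hf.reachable_and_dist_eq x).2

lemma exists_isPath_support (hf : G.IsParentMap w f) (x : V) :
    ∃ p : (parentGraph f).Walk w x, p.IsPath ∧ ∀ u, u ∈ p.support ↔ ∃ m, u = f^[m] x := by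
  have hroot : ∀ m, f^[m] w = w := fun m => Function.iterate_fixed hf.root m
  have hle : ∀ m y, G.dist w (f^[m] y) ≤ G.dist w y := by
    intro m y
    induction m with
    | zero => simp
    | succ m ih =>
      rw [Function.iterate_succ_apply']
      refine le_trans ?_ ih
      by_cases h : f^[m] y = w
      · rw [h, hf.root]
      · have := hf.dist _ h
        omega
  induction hn : G.dist w x generalizing x with
  | zero =>
    by_cases hx : x = w
    · subst hx
      exact ⟨.nil, .nil, fun u => by simp [hroot]⟩
    · have := hf.dist x hx
      omega
  | succ n ih =>
    have hx : x ≠ w := by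
      rintro rfl
      simp at hn
    have hd := hf.dist x hx
    obtain ⟨p, hp, hsupp⟩ := ih (f x) (by omega)
    have hmem : x ∉ p.support := by
      rw [hsupp]
      rintro ⟨m, hm⟩
      have := hle m (f x)
      rw [← hm] at this
      omega
    refine ⟨p.concat (hf.parentGraph_adj_self hx).symm, hp.concat hmem _, fun u => ?_⟩
    rw [Walk.support_concat, List.mem_append, List.mem_singleton, hsupp]
    constructor
    · rintro (⟨m, rfl⟩ | rfl)
      · exact ⟨m + 1, rfl⟩
      · exact ⟨0, rfl⟩
    · rintro ⟨_ | m, rfl⟩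
      · exact Or.inr rfl
      · exact Or.inl ⟨m, rfl⟩

lemma isTreePathVertex_iff [Finite V] (hf : G.IsParentMap w f) {x u : V} {r : ℕ} :
    G.IsTreePathVertex (parentGraph f) w x r u ↔ (∃ m, u = f^[m] x) ∧ G.dist w u = r := by
  obtain ⟨p, hp, hsupp⟩ := hf.exists_isPath_support x
  refine and_congr_left fun _ => ⟨?_, fun h => ⟨p, hp, (hsupp u).2 h⟩⟩
  rintro ⟨q, hq, hu⟩
  rw [← hsupp]
  rwa [(hf.isTree.existsUnique_path w x).unique hp hq]

end IsParentMap

/-! ### Gromov products and the four-point condition -/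

lemma floor_gromovProd {V : Type*} {G : SimpleGraph V} (hG : G.Connected) (w x y : V) :
    ⌊G.gromovProd w x y⌋₊ = (G.dist w x + G.dist w y - G.dist x y) / 2 := by
  have h : G.dist x y ≤ G.dist w x + G.dist w y := by
    have := hG.dist_triangle (u := x) (v := w) (w := y)
    rwa [G.dist_comm (u := x) (v := w)] at this
  rw [← Nat.floor_div_eq_div (K := ℝ), gromovProd, G.dist_comm (u := x) (v := w),
    G.dist_comm (u := y) (v := w), Nat.cast_sub h]
  push_cast
  rfl

/-- The four-point form of hyperbolicity with constant `δ`. -/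
lemma isHyperbolicWith_natCast_of_four_point {V : Type*} {G : SimpleGraph V} {δ : ℕ}
    (h : ∀ w x y z : V, G.dist w z + G.dist x y ≤
      max (G.dist w x + G.dist y z) (G.dist w y + G.dist x z) + 2 * δ) :
    G.IsHyperbolicWith (δ : ℝ) := by
  refine ⟨Nat.cast_nonneg _, fun w x y z => ?_⟩
  have hc : (G.dist w z + G.dist x y : ℝ) ≤
      max (G.dist w x + G.dist y z : ℝ) (G.dist w y + G.dist x z) + 2 * δ := by
    exact_mod_cast h w x y z
  simp only [gromovProd]
  rw [G.dist_comm (u := x) (v := w), G.dist_comm (u := y) (v := w), G.dist_comm (u := z) (v := w)]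
  rcases max_cases (G.dist w x + G.dist y z : ℝ) (G.dist w y + G.dist x z) with ⟨e, -⟩ | ⟨e, -⟩ <;>
    rw [e] at hc
  · linarith [min_le_right (((G.dist w x : ℝ) + G.dist w z - G.dist x z) / 2)
      (((G.dist w y : ℝ) + G.dist w z - G.dist y z) / 2)]
  · linarith [min_le_left (((G.dist w x : ℝ) + G.dist w z - G.dist x z) / 2)
      (((G.dist w y : ℝ) + G.dist w z - G.dist y z) / 2)]

/-- `(w, x, z, y)` is an isometric square of side `δ`. -/
lemma le_of_isHyperbolicWith_of_square {V : Type*} {G : SimpleGraph V} {δ : ℕ} {ε : ℝ}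
    (hε : G.IsHyperbolicWith ε) {w x y z : V} (hwx : G.dist w x = δ) (hwy : G.dist w y = δ)
    (hxz : G.dist x z = δ) (hyz : G.dist y z = δ) (hwz : G.dist w z = 2 * δ)
    (hxy : G.dist x y = 2 * δ) : (δ : ℝ) ≤ ε := by
  have h := hε.2 w x y z
  simp only [gromovProd] at h
  rw [G.dist_comm (u := x) (v := w), G.dist_comm (u := y) (v := w), G.dist_comm (u := z) (v := w),
    hwx, hwy, hxz, hyz, hwz, hxy, min_self] at h
  push_cast at h
  linarith


/-! ### Isometric subgraphs of the integer grid -/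

/-- The `ℓ¹` distance on `ℤ × ℤ`. -/
def l1Dist (p q : ℤ × ℤ) : ℕ := (p.1 - q.1).natAbs + (p.2 - q.2).natAbs

lemma l1Dist_zero_left (p : ℤ × ℤ) : l1Dist 0 p = p.1.natAbs + p.2.natAbs := by
  simp only [l1Dist, Prod.fst_zero, Prod.snd_zero]
  omega

/-- `c` identifies `G` with an induced subgraph of the grid `ℤ × ℤ` in which any two distinct
vertices `x`, `y` admit a neighbour of `y` that is closer to `x` in the `ℓ¹` distance. -/
structure IsGridEmbedding {V : Type*} (G : SimpleGraph V) (c : V → ℤ × ℤ) : Prop where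
  inj : Function.Injective c
  adj : ∀ x y, G.Adj x y ↔ l1Dist (c x) (c y) = 1
  step : ∀ x y, x ≠ y → ∃ z, l1Dist (c y) (c z) = 1 ∧ l1Dist (c x) (c z) + 1 = l1Dist (c x) (c y)

namespace IsGridEmbedding

variable {V : Type*} {G : SimpleGraph V} {c : V → ℤ × ℤ}

lemma reachable_and_dist_eq (hc : G.IsGridEmbedding c) (x y : V) :
    G.Reachable x y ∧ G.dist x y = l1Dist (c x) (c y) := by
  refine reachable_and_dist_eq_of_level (ℓ := fun y => l1Dist (c x) (c y)) (by simp [l1Dist]) ?_ ?_ y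
  · intro y z h
    have := (hc.adj y z).1 h
    simp only [l1Dist] at *
    omega
  · intro y hy
    obtain ⟨z, h1, h2⟩ := hc.step x y hy.symm
    exact ⟨z, (hc.adj y z).2 h1, h2⟩

lemma dist_eq (hc : G.IsGridEmbedding c) (x y : V) : G.dist x y = l1Dist (c x) (c y) :=
  (hc.reachable_and_dist_eq x y).2

lemma connected (hc : G.IsGridEmbedding c) (w : V) : G.Connected where
  preconnected x y := (hc.reachable_and_dist_eq x y).1
  nonempty := ⟨w⟩

/-- A map of the plane that moves every point of the region other than the origin to a neighbour
closer to the origin induces a parent map. -/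
lemma exists_isParentMap (hc : G.IsGridEmbedding c) {w : V} (hw : c w = 0) {F : ℤ × ℤ → ℤ × ℤ}
    (hmem : ∀ p ∈ Set.range c, F p ∈ Set.range c) (h0 : F 0 = 0)
    (hF : ∀ p ∈ Set.range c, p ≠ 0 → l1Dist p (F p) = 1 ∧ l1Dist 0 (F p) + 1 = l1Dist 0 p) :
    ∃ f : V → V, G.IsParentMap w f ∧ ∀ m x, c (f^[m] x) = F^[m] (c x) := by
  choose f hf using fun x => hmem (c x) ⟨x, rfl⟩
  have hne : ∀ x, x ≠ w → c x ≠ 0 := fun x hx h => hx (hc.inj (h.trans hw.symm))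
  refine ⟨f, ⟨hc.inj (by rw [hf, hw, h0]), fun x hx => ?_, fun x hx => ?_⟩, fun m x => ?_⟩
  · rw [hc.adj, hf]
    exact (hF _ ⟨x, rfl⟩ (hne x hx)).1
  · rw [hc.dist_eq, hc.dist_eq, hf, hw]
    exact (hF _ ⟨x, rfl⟩ (hne x hx)).2
  · exact (Function.Semiconj.iterate_right (f := c) (ga := f) (gb := F) hf m) x

end IsGridEmbedding

lemma squareGrid_adj {n : ℕ} (p q : Fin (n + 1) × Fin (n + 1)) :
    (squareGrid n).Adj p q ↔
      ((p.1 : ℤ) - q.1).natAbs + ((p.2 : ℤ) - q.2).natAbs = 1 := by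
  rw [squareGrid, boxProd_adj, pathGraph_adj, pathGraph_adj, Fin.ext_iff, Fin.ext_iff]
  omega

/-! ### The grid without a corner square -/

section CutGrid

variable {k : ℕ}

/-- The coordinates of a vertex of the cut grid. -/
def cutGridCoord (k : ℕ) (x : cutGridVerts k) : ℤ × ℤ := ((x.1.1 : ℕ), (x.1.2 : ℕ))

lemma mem_range_cutGridCoord {p : ℤ × ℤ} : p ∈ Set.range (cutGridCoord k) ↔
    (0 ≤ p.1 ∧ p.1 ≤ 2 * k) ∧ (0 ≤ p.2 ∧ p.2 ≤ 2 * k) ∧ (p.1 ≤ k ∨ p.2 ≤ k) := by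
  constructor
  · rintro ⟨⟨⟨i, j⟩, h⟩, rfl⟩
    simp only [cutGridVerts, Set.mem_ofPred_eq] at h
    simp only [cutGridCoord]
    omega
  · obtain ⟨i, j⟩ := p
    rintro ⟨h1, h2, h3⟩
    simp only at h1 h2 h3
    refine ⟨⟨(⟨i.toNat, by omega⟩, ⟨j.toNat, by omega⟩), ?_⟩, ?_⟩
    · simp only [cutGridVerts, Set.mem_ofPred_eq]
      omega
    · simp only [cutGridCoord, Prod.mk.injEq]
      omega

lemma isGridEmbedding_cutGrid : (cutGrid k).IsGridEmbedding (cutGridCoord k) where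
  inj := by
    rintro ⟨⟨i, j⟩, hx⟩ ⟨⟨i', j'⟩, hy⟩ h
    simp only [cutGridCoord, Prod.mk.injEq, Nat.cast_inj, Fin.val_inj] at h
    obtain ⟨rfl, rfl⟩ := h
    rfl
  adj x y := by
    rw [cutGrid, comap_adj]
    exact squareGrid_adj _ _
  step x y hne := by
    have hx := mem_range_cutGridCoord.1 ⟨x, rfl⟩
    have hy := mem_range_cutGridCoord.1 ⟨y, rfl⟩
    have hne' : ¬ ((cutGridCoord k x).1 = (cutGridCoord k y).1 ∧
        (cutGridCoord k x).2 = (cutGridCoord k y).2) := by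
      rintro ⟨h1, h2⟩
      refine hne (Subtype.ext (Prod.ext (Fin.ext ?_) (Fin.ext ?_))) <;>
        simp only [cutGridCoord] at h1 h2 <;> omega
    suffices h : ∃ q ∈ Set.range (cutGridCoord k), l1Dist (cutGridCoord k y) q = 1 ∧
        l1Dist (cutGridCoord k x) q + 1 = l1Dist (cutGridCoord k x) (cutGridCoord k y) by
      obtain ⟨_, ⟨z, rfl⟩, h⟩ := h
      exact ⟨z, h⟩
    generalize cutGridCoord k x = p at *
    generalize cutGridCoord k y = q at *
    obtain ⟨i, j⟩ := p
    obtain ⟨i', j'⟩ := q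
    simp only [mem_range_cutGridCoord, l1Dist] at *
    -- The region is closed under decreasing coordinates, so a decreasing step is always safe. An
    -- increasing step is taken only when the result is still coordinatewise below `(i, j)`.
    rcases lt_trichotomy i i' with h | h | h
    · exact ⟨(i' - 1, j'), by simp only; omega⟩
    · rcases lt_trichotomy j j' with h' | h' | h'
      · exact ⟨(i', j' - 1), by simp only; omega⟩
      · omega
      · exact ⟨(i', j' + 1), by simp only; omega⟩
    · by_cases h' : j < j'
      · exact ⟨(i', j' - 1), by simp only; omega⟩
      · exact ⟨(i' + 1, j'), by simp only; omega⟩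

lemma natAbs_four_point (w x y z : ℤ) :
    (w - z).natAbs + (x - y).natAbs ≤ (w - x).natAbs + (y - z).natAbs ∨
      (w - z).natAbs + (x - y).natAbs ≤ (w - y).natAbs + (x - z).natAbs := by
  omega

/-- On a line, the excess of the crossing pairing is twice the gap between `{w, y}` and `{x, z}`. -/
lemma separated_of_natAbs_lt {w x y z : ℤ} {n : ℕ}
    (h : (w - y).natAbs + (x - z).natAbs + 2 * n < (w - z).natAbs + (x - y).natAbs) :
    (w + n < x ∧ w + n < z ∧ y + n < x ∧ y + n < z) ∨
      (x + n < w ∧ z + n < w ∧ x + n < y ∧ z + n < y) := by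
  omega

/-- A violation needs gaps larger than `k` in both coordinates, for two different pairings. The four
points then occupy four quadrants, and the upper right one has both coordinates above `k`, inside
the removed square. -/
lemma l1Dist_four_point_of_cut {w x y z : ℤ × ℤ} (hw : w ∈ Set.range (cutGridCoord k))
    (hx : x ∈ Set.range (cutGridCoord k)) (hy : y ∈ Set.range (cutGridCoord k))
    (hz : z ∈ Set.range (cutGridCoord k)) :
    l1Dist w z + l1Dist x y ≤
      max (l1Dist w x + l1Dist y z) (l1Dist w y + l1Dist x z) + 2 * k := by
  rw [mem_range_cutGridCoord] at hw hx hy hz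
  obtain ⟨w1, w2⟩ := w
  obtain ⟨x1, x2⟩ := x
  obtain ⟨y1, y2⟩ := y
  obtain ⟨z1, z2⟩ := z
  simp only [l1Dist] at *
  by_contra! hlt
  rw [← max_add_add_right, max_lt_iff] at hlt
  rcases natAbs_four_point w1 x1 y1 z1 with h1 | h1 <;>
    rcases natAbs_four_point w2 x2 y2 z2 with h2 | h2
  · omega
  · have s1 := separated_of_natAbs_lt (w := w1) (x := x1) (y := y1) (z := z1) (n := k) (by omega)
    have s2 := separated_of_natAbs_lt (w := w2) (x := y2) (y := x2) (z := z2) (n := k) (by omega)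
    clear hlt h1 h2
    omega
  · have s1 := separated_of_natAbs_lt (w := w2) (x := x2) (y := y2) (z := z2) (n := k) (by omega)
    have s2 := separated_of_natAbs_lt (w := w1) (x := y1) (y := x1) (z := z1) (n := k) (by omega)
    clear hlt h1 h2
    omega
  · omega

lemma hasHyperbolicity_cutGrid : (cutGrid k).HasHyperbolicity (k : ℝ) := by
  have hc := isGridEmbedding_cutGrid (k := k)
  constructor
  · refine isHyperbolicWith_natCast_of_four_point fun w x y z => ?_
    simp only [hc.dist_eq]
    exact l1Dist_four_point_of_cut ⟨w, rfl⟩ ⟨x, rfl⟩ ⟨y, rfl⟩ ⟨z, rfl⟩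
  · intro ε hε
    obtain ⟨w, hw⟩ := mem_range_cutGridCoord (k := k) (p := (0, 0)).2 (by simp)
    obtain ⟨x, hx⟩ := mem_range_cutGridCoord (k := k) (p := (k, 0)).2 (by simp; omega)
    obtain ⟨y, hy⟩ := mem_range_cutGridCoord (k := k) (p := (0, k)).2 (by simp; omega)
    obtain ⟨z, hz⟩ := mem_range_cutGridCoord (k := k) (p := (k, k)).2 (by simp; omega)
    refine le_of_isHyperbolicWith_of_square hε (w := w) (x := x) (y := y) (z := z) ?_ ?_ ?_ ?_ ?_ ?_
    all_goals
      rw [hc.dist_eq]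
      simp only [hw, hx, hy, hz, l1Dist]
      omega

/-- Move towards the axis on the same side of the diagonal, and then along it to the origin. -/
def cutGridParent (p : ℤ × ℤ) : ℤ × ℤ :=
  if p.1 < p.2 then (if p.1 = 0 then (p.1, p.2 - 1) else (p.1 - 1, p.2))
  else if p.2 = 0 then (if p.1 = 0 then p else (p.1 - 1, p.2)) else (p.1, p.2 - 1)

lemma cutGridParent_iterate_of_lt {i j : ℤ} (h : i < j) (m : ℕ) (hm : m ≤ i) :
    cutGridParent^[m] (i, j) = (i - m, j) := by
  induction m with
  | zero => simp
  | succ m ih =>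
    rw [Function.iterate_succ_apply', ih (by omega), cutGridParent, if_pos (by simp only; omega),
      if_neg (by simp only; omega)]
    refine Prod.ext ?_ rfl
    simp only
    omega

lemma cutGridParent_iterate_of_le {i j : ℤ} (h : j ≤ i) (m : ℕ) (hm : m ≤ j) :
    cutGridParent^[m] (i, j) = (i, j - m) := by
  induction m with
  | zero => simp
  | succ m ih =>
    rw [Function.iterate_succ_apply', ih (by omega), cutGridParent, if_neg (by simp only; omega),
      if_neg (by simp only; omega)]
    refine Prod.ext rfl ?_
    simp only
    omega

lemma exists_hasRootedInsize_cutGrid (hk : 0 < k) :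
    ∃ (w : cutGridVerts k) (T : SimpleGraph (cutGridVerts k)),
      (cutGrid k).IsBFSTree T w ∧ (cutGrid k).HasRootedInsize T w (4 * k) := by
  have hc := isGridEmbedding_cutGrid (k := k)
  obtain ⟨w, hw⟩ := mem_range_cutGridCoord (k := k) (p := (0, 0)).2 (by simp)
  obtain ⟨x, hx⟩ := mem_range_cutGridCoord (k := k) (p := (k, 2 * k)).2 (by simp; omega)
  obtain ⟨y, hy⟩ := mem_range_cutGridCoord (k := k) (p := (2 * k, k)).2 (by simp; omega)
  obtain ⟨f, hf, hiter⟩ := hc.exists_isParentMap (F := cutGridParent) hw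
    (by
      rintro ⟨i, j⟩ hp
      rw [mem_range_cutGridCoord] at hp ⊢
      simp only [cutGridParent] at *
      split_ifs <;> simp only <;> omega)
    (by simp [cutGridParent])
    (by
      rintro ⟨i, j⟩ hp hne
      rw [mem_range_cutGridCoord] at hp
      rw [Ne, Prod.mk_eq_zero] at hne
      simp only [cutGridParent, l1Dist, Prod.fst_zero, Prod.snd_zero] at *
      split_ifs <;> simp only <;> omega)
  -- Here `(x|y)_w = (3k + 3k - 2k) / 2 = 2k`, and `k` steps from `x`, `y` lead to `(0, 2k)`, `(2k,
  -- 0)`.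
  refine ⟨w, parentGraph f, hf.isBFSTree, ⟨x, y, f^[k] x, f^[k] y, ?_, ?_, ?_⟩, ?_⟩
  · rw [hf.isTreePathVertex_iff, floor_gromovProd (hc.connected w)]
    refine ⟨⟨k, rfl⟩, ?_⟩
    simp only [hc.dist_eq, hiter, hw, hx, hy]
    rw [cutGridParent_iterate_of_lt (by omega) _ (by omega)]
    simp only [l1Dist]
    omega
  · rw [hf.isTreePathVertex_iff, floor_gromovProd (hc.connected w)]
    refine ⟨⟨k, rfl⟩, ?_⟩
    simp only [hc.dist_eq, hiter, hw, hx, hy]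
    rw [cutGridParent_iterate_of_le (by omega) _ (by omega)]
    simp only [l1Dist]
    omega
  · simp only [hc.dist_eq, hiter, hx, hy]
    rw [cutGridParent_iterate_of_lt (by omega) _ (by omega),
      cutGridParent_iterate_of_le (by omega) _ (by omega)]
    simp only [l1Dist]
    omega
  · rintro _ ⟨_, _, u, v, -, -, rfl⟩
    have hu := mem_range_cutGridCoord.1 ⟨u, rfl⟩
    have hv := mem_range_cutGridCoord.1 ⟨v, rfl⟩
    rw [hc.dist_eq]
    simp only [l1Dist]
    omega

end CutGrid


/-! ### The full grid rooted at its centre -/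

section CenteredGrid

variable {k : ℕ}

/-- The coordinates of a vertex of the `4k × 4k` grid, with the origin at the centre. -/
def centeredCoord (k : ℕ) (x : Fin (4 * k + 1) × Fin (4 * k + 1)) : ℤ × ℤ :=
  ((x.1 : ℕ) - 2 * k, (x.2 : ℕ) - 2 * k)

lemma mem_range_centeredCoord {p : ℤ × ℤ} : p ∈ Set.range (centeredCoord k) ↔
    p.1.natAbs ≤ 2 * k ∧ p.2.natAbs ≤ 2 * k := by
  constructor
  · rintro ⟨⟨i, j⟩, rfl⟩
    simp only [centeredCoord]
    omega
  · obtain ⟨i, j⟩ := p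
    rintro ⟨h1, h2⟩
    simp only at h1 h2
    refine ⟨(⟨(i + 2 * k).toNat, by omega⟩, ⟨(j + 2 * k).toNat, by omega⟩), ?_⟩
    simp only [centeredCoord, Prod.mk.injEq]
    omega

lemma isGridEmbedding_squareGrid :
    (squareGrid (4 * k)).IsGridEmbedding (centeredCoord k) where
  inj := by
    rintro ⟨i, j⟩ ⟨i', j'⟩ h
    simp only [centeredCoord, Prod.mk.injEq] at h
    ext <;> simp only <;> omega
  adj x y := by
    rw [squareGrid_adj]
    simp only [centeredCoord, l1Dist, sub_sub_sub_cancel_right]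
  step x y hne := by
    have hx := mem_range_centeredCoord.1 ⟨x, rfl⟩
    have hy := mem_range_centeredCoord.1 ⟨y, rfl⟩
    have hne' : ¬ ((centeredCoord k x).1 = (centeredCoord k y).1 ∧
        (centeredCoord k x).2 = (centeredCoord k y).2) := by
      rintro ⟨h1, h2⟩
      refine hne (Prod.ext (Fin.ext ?_) (Fin.ext ?_)) <;>
        simp only [centeredCoord] at h1 h2 <;> omega
    suffices h : ∃ q ∈ Set.range (centeredCoord k), l1Dist (centeredCoord k y) q = 1 ∧
        l1Dist (centeredCoord k x) q + 1 = l1Dist (centeredCoord k x) (centeredCoord k y) by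
      obtain ⟨_, ⟨z, rfl⟩, h⟩ := h
      exact ⟨z, h⟩
    generalize centeredCoord k x = p at *
    generalize centeredCoord k y = q at *
    obtain ⟨i, j⟩ := p
    obtain ⟨i', j'⟩ := q
    simp only [mem_range_centeredCoord, l1Dist] at *
    rcases lt_trichotomy i i' with h | h | h
    · exact ⟨(i' - 1, j'), by simp only; omega⟩
    · rcases lt_trichotomy j j' with h' | h' | h'
      · exact ⟨(i', j' - 1), by simp only; omega⟩
      · omega
      · exact ⟨(i', j' + 1), by simp only; omega⟩
    · exact ⟨(i' + 1, j'), by simp only; omega⟩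

lemma natAbs_sub_add_natAbs_sub_le {n : ℕ} {w x y z : ℤ} (hw : w.natAbs ≤ n) (hx : x.natAbs ≤ n)
    (hy : y.natAbs ≤ n) (hz : z.natAbs ≤ n) : (w - z).natAbs + (x - y).natAbs ≤ 4 * n := by
  omega

lemma l1Dist_four_point_of_natAbs_le {n : ℕ} {w x y z : ℤ × ℤ}
    (hw : w.1.natAbs ≤ n ∧ w.2.natAbs ≤ n) (hx : x.1.natAbs ≤ n ∧ x.2.natAbs ≤ n)
    (hy : y.1.natAbs ≤ n ∧ y.2.natAbs ≤ n) (hz : z.1.natAbs ≤ n ∧ z.2.natAbs ≤ n) :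
    l1Dist w z + l1Dist x y ≤
      max (l1Dist w x + l1Dist y z) (l1Dist w y + l1Dist x z) + 4 * n := by
  have b := natAbs_sub_add_natAbs_sub_le hw.2 hx.2 hy.2 hz.2
  simp only [l1Dist]
  rcases natAbs_four_point w.1 x.1 y.1 z.1 with h | h
  · refine le_trans ?_ (Nat.add_le_add_right (le_max_left _ _) _)
    linarith [Nat.zero_le ((w.2 - x.2).natAbs), Nat.zero_le ((y.2 - z.2).natAbs)]
  · refine le_trans ?_ (Nat.add_le_add_right (le_max_right _ _) _)
    linarith [Nat.zero_le ((w.2 - y.2).natAbs), Nat.zero_le ((x.2 - z.2).natAbs)]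

lemma hasHyperbolicity_squareGrid :
    (squareGrid (4 * k)).HasHyperbolicity (4 * (k : ℝ)) := by
  have hc := isGridEmbedding_squareGrid (k := k)
  have hcast : (4 * (k : ℝ)) = ((4 * k : ℕ) : ℝ) := by push_cast; rfl
  rw [hcast]
  constructor
  · refine isHyperbolicWith_natCast_of_four_point fun w x y z => ?_
    simp only [hc.dist_eq]
    refine (l1Dist_four_point_of_natAbs_le (mem_range_centeredCoord.1 ⟨w, rfl⟩)
      (mem_range_centeredCoord.1 ⟨x, rfl⟩) (mem_range_centeredCoord.1 ⟨y, rfl⟩)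
      (mem_range_centeredCoord.1 ⟨z, rfl⟩)).trans_eq ?_
    ring
  · intro ε hε
    obtain ⟨w, hw⟩ := mem_range_centeredCoord (k := k) (p := (-(2 * k), -(2 * k))).2
      (by simp only; omega)
    obtain ⟨x, hx⟩ := mem_range_centeredCoord (k := k) (p := (2 * k, -(2 * k))).2
      (by simp only; omega)
    obtain ⟨y, hy⟩ := mem_range_centeredCoord (k := k) (p := (-(2 * k), 2 * k)).2
      (by simp only; omega)
    obtain ⟨z, hz⟩ := mem_range_centeredCoord (k := k) (p := (2 * k, 2 * k)).2
      (by simp only; omega)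
    refine le_of_isHyperbolicWith_of_square hε (w := w) (x := x) (y := y) (z := z) ?_ ?_ ?_ ?_ ?_ ?_
    all_goals
      rw [hc.dist_eq]
      simp only [hw, hx, hy, hz, l1Dist]
      omega

/-- Move parallel to an axis to the nearest diagonal, and then along the diagonal to the origin. -/
def diagonalParent (p : ℤ × ℤ) : ℤ × ℤ :=
  if p.2.natAbs < p.1.natAbs then (p.1 - p.1.sign, p.2) else (p.1, p.2 - p.2.sign)

lemma natAbs_sub_sign (i : ℤ) : (i - i.sign).natAbs = i.natAbs - 1 := by
  rcases lt_trichotomy i 0 with h | rfl | h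
  · rw [Int.sign_eq_neg_one_of_neg h]; omega
  · rfl
  · rw [Int.sign_eq_one_of_pos h]; omega

lemma sub_sign_between {i j : ℤ} (h : 0 ≤ i ∧ i ≤ j ∨ j ≤ i ∧ i ≤ 0) :
    0 ≤ i - i.sign ∧ i - i.sign ≤ j ∨ j ≤ i - i.sign ∧ i - i.sign ≤ 0 := by
  rcases lt_trichotomy i 0 with h | rfl | h
  · rw [Int.sign_eq_neg_one_of_neg h]; omega
  · simpa using h
  · rw [Int.sign_eq_one_of_pos h]; omega

/-- `u` lies on the path from the origin to `x` along which `diagonalParent` moves. -/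
structure IsDiagonalAncestor (x u : ℤ × ℤ) : Prop where
  fst_between : 0 ≤ u.1 ∧ u.1 ≤ x.1 ∨ x.1 ≤ u.1 ∧ u.1 ≤ 0
  snd_between : 0 ≤ u.2 ∧ u.2 ≤ x.2 ∨ x.2 ≤ u.2 ∧ u.2 ≤ 0
  -- With `r` the distance of `u` from the origin, this clamps `r / 2`, the value on the diagonal,
  -- to the range `[r - |x.1|, |x.2|]` allowed by `x`. The floor matches `diagonalParent`, which
  -- lowers the second coordinate on ties.
  natAbs_snd : u.2.natAbs = max (u.1.natAbs + u.2.natAbs - x.1.natAbs)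
    (min x.2.natAbs ((u.1.natAbs + u.2.natAbs) / 2))

lemma isDiagonalAncestor_iterate (x : ℤ × ℤ) (m : ℕ) :
    IsDiagonalAncestor x (diagonalParent^[m] x) := by
  induction m with
  | zero => constructor <;> simp only [Function.iterate_zero, id_eq] <;> omega
  | succ m ih =>
    rw [Function.iterate_succ_apply']
    generalize diagonalParent^[m] x = u at ih
    obtain ⟨h1, h2, h3⟩ := ih
    rw [diagonalParent]
    split_ifs with h
    · refine ⟨sub_sign_between h1, h2, ?_⟩
      simp only [natAbs_sub_sign]
      omega
    · refine ⟨h1, sub_sign_between h2, ?_⟩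
      simp only [natAbs_sub_sign]
      omega

/-- Same sign or opposite signs: a coordinate contributes `min |x| |y|` to the Gromov product in the
first case and `0` in the second. -/
lemma natAbs_sub_of_between {x y u v : ℤ} (hu : 0 ≤ u ∧ u ≤ x ∨ x ≤ u ∧ u ≤ 0)
    (hv : 0 ≤ v ∧ v ≤ y ∨ y ≤ v ∧ v ≤ 0) :
    x.natAbs + y.natAbs - (x - y).natAbs = 2 * min x.natAbs y.natAbs ∧
        (x - y).natAbs ≤ x.natAbs + y.natAbs ∧
        (u - v).natAbs = max u.natAbs v.natAbs - min u.natAbs v.natAbs ∨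
      (x - y).natAbs = x.natAbs + y.natAbs ∧ (u - v).natAbs = u.natAbs + v.natAbs := by
  omega

/-- Since `r - x1 ≤ m2 ≤ x2`, clamping moves `r / 2` towards `m2` but never past it. -/
lemma natAbs_snd_mem_Icc {x1 x2 m1 m2 r u2 : ℕ} (h1 : m1 ≤ x1) (h2 : m2 ≤ x2) (hr : r = m1 + m2)
    (hu : u2 = max (r - x1) (min x2 (r / 2))) :
    min m2 (r / 2) ≤ u2 ∧ u2 ≤ max m2 (r / 2) := by
  omega

lemma l1Dist_le_of_isDiagonalAncestor (hk : 0 < k) {x y u v : ℤ × ℤ}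
    (hx : x.1.natAbs ≤ 2 * k ∧ x.2.natAbs ≤ 2 * k) (hy : y.1.natAbs ≤ 2 * k ∧ y.2.natAbs ≤ 2 * k)
    (hxu : IsDiagonalAncestor x u) (hyv : IsDiagonalAncestor y v)
    (hu : l1Dist 0 u = (l1Dist 0 x + l1Dist 0 y - l1Dist x y) / 2)
    (hv : l1Dist 0 v = (l1Dist 0 x + l1Dist 0 y - l1Dist x y) / 2) : l1Dist u v ≤ 2 * k := by
  obtain ⟨u1, u2, hu3⟩ := hxu
  obtain ⟨v1, v2, hv3⟩ := hyv
  have c1 := natAbs_sub_of_between u1 v1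
  have c2 := natAbs_sub_of_between u2 v2
  clear u1 u2 v1 v2
  simp only [l1Dist_zero_left] at hu hv
  rw [hu] at hu3
  rw [hv] at hv3
  simp only [l1Dist] at hu hv hu3 hv3 ⊢
  generalize (x.1 - y.1).natAbs = d1 at *
  generalize (x.2 - y.2).natAbs = d2 at *
  generalize (u.1 - v.1).natAbs = e1 at *
  generalize (u.2 - v.2).natAbs = e2 at *
  generalize x.1.natAbs = x1, x.2.natAbs = x2, y.1.natAbs = y1, y.2.natAbs = y2 at *
  generalize u.1.natAbs = u1, u.2.natAbs = u2, v.1.natAbs = v1, v.2.natAbs = v2 at *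
  generalize hr : (x1 + x2 + (y1 + y2) - (d1 + d2)) / 2 = r at *
  rcases c1 with ⟨c1, c1', rfl⟩ | ⟨rfl, rfl⟩ <;> rcases c2 with ⟨c2, c2', rfl⟩ | ⟨rfl, rfl⟩
  · have hr' : r = min x1 y1 + min x2 y2 := by omega
    have hm : min x1 y1 ≤ 2 * k ∧ min x2 y2 ≤ 2 * k := by omega
    have bu := natAbs_snd_mem_Icc (min_le_left x1 y1) (min_le_left x2 y2) hr' hu3
    have bv := natAbs_snd_mem_Icc (min_le_right x1 y1) (min_le_right x2 y2) hr' hv3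
    -- As `u1 + u2 = v1 + v2 = r`, the distance is `2|u2 - v2| ≤ 2|m2 - r / 2|`. This is at most
    -- `|m1 - m2|`, plus one for rounding when that difference is odd, hence less than `2k`.
    clear hr c1 c1' c2 c2' d1 d2 hu3 hv3 hx hy
    generalize min x1 y1 = m1 at *
    generalize min x2 y2 = m2 at *
    omega
  -- Now `u2, v2 ≤ r / 2` and the distance is `2 max u2 v2 ≤ r ≤ 2k`; the next case is analogous up
  -- to rounding.
  · have hr' : r = min x1 y1 := by omega
    clear hr c1 c1' d1
    omega
  · have hr' : r = min x2 y2 := by omega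
    clear hr c2 c2' d2
    omega
  · omega

lemma exists_hasRootedInsize_squareGrid (hk : 0 < k) :
    ∃ (w : Fin (4 * k + 1) × Fin (4 * k + 1))
      (T : SimpleGraph (Fin (4 * k + 1) × Fin (4 * k + 1))) (ρ : ℕ),
      (squareGrid (4 * k)).IsBFSTree T w ∧ (squareGrid (4 * k)).HasRootedInsize T w ρ ∧
        ρ ≤ 2 * k := by
  have hc := isGridEmbedding_squareGrid (k := k)
  obtain ⟨w, hw⟩ := mem_range_centeredCoord (k := k) (p := 0).2 (by simp)
  obtain ⟨f, hf, hiter⟩ := hc.exists_isParentMap (F := diagonalParent) hw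
    (by
      intro p hp
      rw [mem_range_centeredCoord] at hp ⊢
      rw [diagonalParent]
      split_ifs <;> simp only [natAbs_sub_sign] <;> omega)
    (by simp [diagonalParent])
    (by
      rintro ⟨i, j⟩ - hne
      rw [Ne, Prod.mk_eq_zero] at hne
      have h1 : i ≠ 0 → i.sign.natAbs = 1 := Int.natAbs_sign_of_ne_zero
      have h2 : j ≠ 0 → j.sign.natAbs = 1 := Int.natAbs_sign_of_ne_zero
      rw [diagonalParent, l1Dist_zero_left, l1Dist_zero_left]
      split_ifs with h <;> simp only [natAbs_sub_sign, l1Dist] at h ⊢ <;> omega)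
  have hbound : ∀ n ∈ (squareGrid (4 * k)).rootedInsizeSet (parentGraph f) w, n ≤ 2 * k := by
    rintro _ ⟨x, y, u, v, hu, hv, rfl⟩
    rw [hf.isTreePathVertex_iff, floor_gromovProd (hc.connected w)] at hu hv
    obtain ⟨⟨m, rfl⟩, hu⟩ := hu
    obtain ⟨⟨n, rfl⟩, hv⟩ := hv
    simp only [hc.dist_eq, hiter, hw] at hu hv ⊢
    exact l1Dist_le_of_isDiagonalAncestor hk (mem_range_centeredCoord.1 ⟨x, rfl⟩)
      (mem_range_centeredCoord.1 ⟨y, rfl⟩) (isDiagonalAncestor_iterate _ _)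
      (isDiagonalAncestor_iterate _ _) hu hv
  have hne : ((squareGrid (4 * k)).rootedInsizeSet (parentGraph f) w).Nonempty := by
    refine ⟨_, w, w, w, w, ?_, ?_, rfl⟩ <;>
    · rw [hf.isTreePathVertex_iff, floor_gromovProd (hc.connected w)]
      exact ⟨⟨0, rfl⟩, by simp⟩
  refine ⟨w, parentGraph f, _, hf.isBFSTree, ⟨Nat.sSup_mem hne ⟨_, hbound⟩, fun n hn =>
    le_csSup ⟨_, hbound⟩ hn⟩, csSup_le hne hbound⟩

end CenteredGrid

end SimpleGraph

/-! ### Optimality of the constants -/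

theorem mainTheorem5 :
    (∀ k : ℕ, 0 < k →
      (SimpleGraph.cutGrid k).HasHyperbolicity (k : ℝ) ∧
      ∃ (w : SimpleGraph.cutGridVerts k) (T : SimpleGraph (SimpleGraph.cutGridVerts k)),
        (SimpleGraph.cutGrid k).IsBFSTree T w ∧
        (SimpleGraph.cutGrid k).HasRootedInsize T w (4 * k)) ∧
    (∀ k : ℕ, 0 < k →
      (SimpleGraph.squareGrid (4 * k)).HasHyperbolicity (4 * (k : ℝ)) ∧
      ∃ (w : Fin (4 * k + 1) × Fin (4 * k + 1))
        (T : SimpleGraph (Fin (4 * k + 1) × Fin (4 * k + 1))) (ρ : ℕ),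
        (SimpleGraph.squareGrid (4 * k)).IsBFSTree T w ∧
        (SimpleGraph.squareGrid (4 * k)).HasRootedInsize T w ρ ∧
        ρ ≤ 2 * k) ∧
    (∀ a b : ℝ,
      (∀ (V : Type) [Finite V] (G T : SimpleGraph V) (w : V) (δ : ℝ) (ρ : ℕ),
        G.IsBFSTree T w → G.HasHyperbolicity δ → G.HasRootedInsize T w ρ →
          (ρ : ℝ) ≤ a * δ + b) → 4 ≤ a) ∧
    (∀ a b : ℝ,
      (∀ (V : Type) [Finite V] (G T : SimpleGraph V) (w : V) (δ : ℝ) (ρ : ℕ),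
        G.IsBFSTree T w → G.HasHyperbolicity δ → G.HasRootedInsize T w ρ →
          δ ≤ a * (ρ : ℝ) + b) → 2 ≤ a) := by
  have hlarge : ∀ s t : ℝ, 0 < s → ∃ k : ℕ, 0 < k ∧ t < k * s := by
    intro s t hs
    obtain ⟨k, hk⟩ := exists_nat_gt (t / s)
    refine ⟨k + 1, k.succ_pos, (div_lt_iff₀ hs).1 (hk.trans ?_)⟩
    push_cast
    linarith
  refine ⟨fun k hk => ⟨SimpleGraph.hasHyperbolicity_cutGrid,
    SimpleGraph.exists_hasRootedInsize_cutGrid hk⟩, fun k hk =>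
    ⟨SimpleGraph.hasHyperbolicity_squareGrid, SimpleGraph.exists_hasRootedInsize_squareGrid hk⟩,
    fun a b h => ?_, fun a b h => ?_⟩
  · by_contra! ha
    obtain ⟨k, hk, hlt⟩ := hlarge (4 - a) b (by linarith)
    obtain ⟨w, T, hT, hρ⟩ := SimpleGraph.exists_hasRootedInsize_cutGrid hk
    have := h _ _ T w _ _ hT SimpleGraph.hasHyperbolicity_cutGrid hρ
    push_cast at this
    linarith
  · by_contra! ha
    -- Only `ρ ≤ 2k` is known, so a negative `a` is replaced by `0` before multiplying.
    have hpos : 0 < 4 - 2 * max a 0 := by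
      have : max a 0 < 2 := max_lt ha two_pos
      linarith
    obtain ⟨k, hk, hlt⟩ := hlarge _ b hpos
    obtain ⟨w, T, ρ, hT, hρ, hle⟩ := SimpleGraph.exists_hasRootedInsize_squareGrid hk
    have h1 := h _ _ T w _ _ hT SimpleGraph.hasHyperbolicity_squareGrid hρ
    have h2 : a * (ρ : ℝ) ≤ max a 0 * (2 * k) :=
      mul_le_mul (le_max_left _ _) (by exact_mod_cast hle) (Nat.cast_nonneg _) (le_max_right _ _)
    linarith
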